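/- All Hilbert spaces are complex; inner products are antilinear in the first and linear in the second variable. For a Hilbert space $H$, $H'$ is the space of continuous linear forms on $H$ and $\langle f,e\rangle_{H',H}:=f(e)=:\overline{\langle e,f\rangle_{H,H'}}$, regarded as antilinear in $f$ (scalars act on $H'$ through their conjugates, and operators with values in $H'$ are linear for that action). **Setting.** Let $\mathcal X^1,\mathcal X^2,\mathcal U^1,\mathcal U^2$ be Hilbert spaces, $L$ a closed densely defined operator from $\mathcal X^1$ to $\mathcal X^2$ with domain $\mathcal Z^1$, and $K$ a closed densely defined operator from $\mathcal X^2$ to $\mathcal X^1$ with domain $\mathcal Z^2$; $\mathcal Z^1,\mathcal Z^2$ carry the graph norms. Let $\gamma^i\in\mathcal L(\mathcal Z^i,\mathcal U^i)$, $\beta^1\in\mathcal L(\mathcal Z^1,(\mathcal U^2)')$, $\beta^2\in\mathcal L(\mathcal Z^2,(\mathcal U^1)')$ satisfy, for all $e^1\in\mathcal Z^1$, $e^2\in\mathcal Z^2$, $$(Le^1,e^2)_{\mathcal X^2}=(e^1,Ke^2)_{\mathcal X^1}+\langle\gamma^1e^1,\beta^2e^2\rangle_{\mathcal U^1,(\mathcal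 U^1)'}+\langle\beta^1e^1,\gamma^2e^2\rangle_{(\mathcal U^2)',\mathcal U^2}.$$ Put $\mathcal X=\mathcal X^1\times\mathcal X^2$, $\mathcal Z=\mathcal Z^1\times\mathcal Z^2$, $\mathcal U=\mathcal U^1\times\mathcal U^2$, $J=\begin{bmatrix}0&-K\\L&0\end{bmatrix}\in\mathcal L(\mathcal Z,\mathcal X)$, $G=\begin{bmatrix}\gamma^1&0\\0&\gamma^2\end{bmatrix}\in\mathcal L(\mathcal Z,\mathcal U)$, $\mathcal X^i_1=\ker\gamma^i$, $\mathcal X^i_0=\ker\gamma^i\cap\ker\beta^i$, and $A=J|_{\ker G}$, an unbounded operator on $\mathcal X$. **Assumptions.** Assume that $\gamma^i$ is onto and $\mathcal X^i_1$ is dense in $\mathcal X^i$ for $i=1,2$, and that at least one of the following holds: (a) $\mathcal X^1_0$ is dense in $\mathcal X^1$, $\beta^1$ maps $\mathcal X^1_1$ onto $(\mathcal U^2)'$, and $\mathcal Z^2$ is maximal in the following sense: if $v\in\mathcal X^2$ and $w\in\mathcal X^1$ satisfy $(L\varphi,v)_{\mathcal X^2}=(\varphi,w)_{\mathcal X^1}$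 for all $\varphi\in\mathcal X^1_0$, then $v\in\mathcal Z^2$ (that is, $\mathcal Z^2=\{v\in\mathcal X^2: Kv\in\mathcal X^1\}$ with $Kv$ understood in the weak sense, tested on $\mathcal X^1_0$); (b) $\mathcal X^2_0$ is dense in $\mathcal X^2$, $\beta^2$ maps $\mathcal X^2_1$ onto $(\mathcal U^1)'$, and $\mathcal Z^1$ is maximal in the following sense: if $v\in\mathcal X^1$ and $w\in\mathcal X^2$ satisfy $(K\varphi,v)_{\mathcal X^1}=(\varphi,w)_{\mathcal X^2}$ for all $\varphi\in\mathcal X^2_0$, then $v\in\mathcal Z^1$. **Theorem.** 1. $(J,G)$ is a boundary control system on $(\mathcal Z,\mathcal X,\mathcal U)$: $\mathcal Z,\mathcal X,\mathcal U$ are Hilbert spaces with $\mathcal Z$ continuously embedded in $\mathcal X$, $G$ is onto, $\ker G$ is dense in $\mathcal X$, and for some $b\in\mathbb C$ the operator $bI-J$ maps $\ker G$ onto $\mathcal X$ and $\ker(bI-J)\cap\ker G=\{0\}$. Moreover $I-A$ has a (unique) bounded inverse $(I-A)^{-1}\in\mathcal L(\mathcal X)$. 2. Let $\mathcal X_{-1}$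 be the completion of $\mathcal X$ for the norm $\|(I-A)^{-1}\cdot\|_{\mathcal X}$. Then $\mathcal X$ embeds in $\mathcal X_{-1}$, $A$ has a unique extension $A|_{\mathcal X}\in\mathcal L(\mathcal X,\mathcal X_{-1})$, and $\mathcal X_{-1}=\mathcal X^1_{-1}\oplus\mathcal X^2_{-1}$, where $\mathcal X^1_{-1}$ and $\mathcal X^2_{-1}$ are the closures of $\mathcal X^1\times\{0\}$ and $\{0\}\times\mathcal X^2$ in $\mathcal X_{-1}$. 3. There are unique $B^1\in\mathcal L(\mathcal U^1,\mathcal X^2_{-1})$ and $B^2\in\mathcal L(\mathcal U^2,\mathcal X^1_{-1})$ such that $B=\begin{bmatrix}0&B^2\\B^1&0\end{bmatrix}$ is the control operator of $(J,G)$, i.e. $J=A|_{\mathcal X}+BG$ on $\mathcal Z$ and $G(bI-A|_{\mathcal X})^{-1}B=I_{\mathcal U}$ for every $b$ in the resolvent set of $A$; and this $B$ is the only operator in $\mathcal L(\mathcal U,\mathcal X_{-1})$ with $J=A|_{\mathcal X}+BG$. 4. Let $\mathcal E=\{(e,u)\in\mathcal X\times\mathcal U:\ A|_{\mathcal X}e+Bu\in\mathcal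 X\}$, a Hilbert space with the graph norm $(\|e\|_{\mathcal X}^2+\|u\|_{\mathcal U}^2+\|A|_{\mathcal X}e+Bu\|_{\mathcal X}^2)^{1/2}$, and $\mathcal F=\mathcal E'$. Every $(e,u)\in\mathcal E$ satisfies $e\in\mathcal Z$ and $Ge=u$, and $$\mathcal J=\begin{bmatrix}A|_{\mathcal X}&B\\-\begin{bmatrix}0&\beta^2\\\beta^1&0\end{bmatrix}&0\end{bmatrix},\qquad \big\langle\mathcal J(e,u),(x,v)\big\rangle_{\mathcal F,\mathcal E}=(A|_{\mathcal X}e+Bu,x)_{\mathcal X}-\langle\beta^2e^2,v^1\rangle_{(\mathcal U^1)',\mathcal U^1}-\langle\beta^1e^1,v^2\rangle_{(\mathcal U^2)',\mathcal U^2},$$ defines an operator $\mathcal J\in\mathcal L(\mathcal E,\mathcal F)$ whose graph $\mathcal D=\{(\mathcal J\varepsilon,\varepsilon):\varepsilon\in\mathcal E\}$ is a Stokes-Dirac structure in $\mathcal F\times\mathcal E$: $\mathcal D$ equals the set of all $(f,\varepsilon)\in\mathcal F\times\mathcal E$ with $\overline{\langle f,\varepsilon'\rangle_{\mathcal F,\mathcal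 E}}+\langle f',\varepsilon\rangle_{\mathcal F,\mathcal E}=0$ for all $(f',\varepsilon')\in\mathcal D$. -/

import Mathlib

open scoped InnerProductSpace ComplexConjugate

noncomputable section

namespace PortHamiltonian

/-! ### The domain of an operator with its graph norm -/

section GraphSpace

variable {X Y : Type*} [NormedAddCommGroup X] [InnerProductSpace ℂ X]
  [NormedAddCommGroup Y] [InnerProductSpace ℂ Y]

/-- The domain of an unbounded operator `T` from `X` to `Y`, with the graph norm
`‖z‖² = ‖z‖_X² + ‖T z‖_Y²`. A point of the domain is stored as the pair `(z, T z)`. -/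
abbrev GraphSpace (T : X →ₗ.[ℂ] Y) : Submodule ℂ (WithLp 2 (X × Y)) :=
  T.graph.comap (WithLp.prodContinuousLinearEquiv 2 ℂ X Y).toLinearMap

/-- The embedding of the domain of `T` into `X`. -/
def GraphSpace.emb (T : X →ₗ.[ℂ] Y) : GraphSpace T →L[ℂ] X :=
  (WithLp.fstL 2 ℂ X Y).comp (GraphSpace T).subtypeL

/-- The operator `T` as a bounded operator on its domain with the graph norm. -/
def GraphSpace.op (T : X →ₗ.[ℂ] Y) : GraphSpace T →L[ℂ] Y :=
  (WithLp.sndL 2 ℂ X Y).comp (GraphSpace T).subtypeL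

end GraphSpace

/-! ### Bond spaces and Stokes-Dirac structures -/

section StokesDirac

variable {E : Type*} [NormedAddCommGroup E] [InnerProductSpace ℂ E]

/-- The bond product on `E' × E`, where `E'` consists of the continuous linear forms on `E`. -/
def bondProduct (b c : StrongDual ℂ E × E) : ℂ :=
  conj (b.1 c.2) + c.1 b.2

/-- The orthogonal companion of a subset of the bond space. -/
def orthogonalCompanion (D : Set (StrongDual ℂ E × E)) : Set (StrongDual ℂ E × E) :=
  {b | ∀ c ∈ D, bondProduct b c = 0}

/-- Stokes-Dirac structures in the bond space `E' × E` over a Hilbert space `E`. (A set that equals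
its orthogonal companion is a closed subspace, with the conjugate scalar multiplication on `E'`.) -/
def IsStokesDirac [CompleteSpace E] (D : Set (StrongDual ℂ E × E)) : Prop :=
  orthogonalCompanion D = D

/-- The graph `{(T e, e)}` of an operator `T : E → E'`. The operator is conjugate-linear in the
usual scalar multiplication of `E'`, because the duality bracket `⟨f, e⟩ = f e` is taken to be
antilinear in `f`. -/
def dualGraph (T : E →L⋆[ℂ] StrongDual ℂ E) : Set (StrongDual ℂ E × E) :=
  {b | b.1 = T b.2}

end StokesDirac

/-! ### Boundary control systems -/

section BCS

variable {Z X U : Type*}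
  [NormedAddCommGroup Z] [InnerProductSpace ℂ Z]
  [NormedAddCommGroup X] [InnerProductSpace ℂ X]
  [NormedAddCommGroup U] [InnerProductSpace ℂ U]

/-- `(J, G)` is a boundary control system on `(Z, X, U)`, where the Hilbert space `Z` is
continuously embedded in the Hilbert space `X` by `ι`. -/
structure IsBoundaryControlSystem (ι : Z →L[ℂ] X) (J : Z →L[ℂ] X) (G : Z →L[ℂ] U) : Prop where
  complete_solution : CompleteSpace Z
  complete_state : CompleteSpace X
  complete_input : CompleteSpace U
  injective : Function.Injective ι
  surjective : Function.Surjective G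
  dense : Dense (ι '' {z | G z = 0})
  exists_resolvent : ∃ b : ℂ,
    (∀ x : X, ∃ z : Z, G z = 0 ∧ b • ι z - J z = x) ∧
    (∀ z : Z, b • ι z - J z = 0 → G z = 0 → z = 0)

/-- `R` is the inverse of `b I - A`, where `A` is the restriction of `J` to `ker G`, seen as an
unbounded operator on `X`. -/
structure IsResolvent (ι : Z →L[ℂ] X) (J : Z →L[ℂ] X) (G : Z →L[ℂ] U) (b : ℂ) (R : X →L[ℂ] X) :
    Prop where
  left_inv : ∀ z : Z, G z = 0 → R (b • ι z - J z) = ι z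
  right_inv : ∀ x : X, ∃ z : Z, G z = 0 ∧ ι z = R x ∧ b • ι z - J z = x

end BCS

/-! ### The extrapolation space -/

section Extrapolation

variable {X : Type*} [NormedAddCommGroup X] [InnerProductSpace ℂ X]

/-- A copy of `X`, to be endowed with the norm `‖R x‖`. -/
def PreExtrapolation (_R : X →L[ℂ] X) : Type _ := X

instance (R : X →L[ℂ] X) : AddCommGroup (PreExtrapolation R) :=
  inferInstanceAs (AddCommGroup X)

instance (R : X →L[ℂ] X) : Module ℂ (PreExtrapolation R) :=
  inferInstanceAs (Module ℂ X)

/-- `R`, as a linear map on the copy of `X`. -/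
def PreExtrapolation.map (R : X →L[ℂ] X) : PreExtrapolation R →ₗ[ℂ] X :=
  R.toLinearMap

instance (R : X →L[ℂ] X) : SeminormedAddCommGroup (PreExtrapolation R) :=
  SeminormedAddCommGroup.induced (PreExtrapolation R) X (PreExtrapolation.map R)

instance (R : X →L[ℂ] X) : NormedSpace ℂ (PreExtrapolation R) :=
  NormedSpace.induced ℂ (PreExtrapolation R) X (PreExtrapolation.map R)

/-- The completion `X₋₁` of `X` with the norm `‖R x‖`; here `R` will be `(I - A)⁻¹`. -/
abbrev Extrapolation (R : X →L[ℂ] X) : Type _ :=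
  UniformSpace.Completion (PreExtrapolation R)

/-- The identity from `X` to its copy. -/
def toPreExtrapolation (R : X →L[ℂ] X) : X →ₗ[ℂ] PreExtrapolation R :=
  (LinearMap.id : X →ₗ[ℂ] X)

theorem norm_toPreExtrapolation (R : X →L[ℂ] X) (x : X) :
    ‖toPreExtrapolation R x‖ = ‖R x‖ := rfl

/-- The canonical map from `X` to `X₋₁`. -/
def toExtrapolation (R : X →L[ℂ] X) : X →L[ℂ] Extrapolation R :=
  (UniformSpace.Completion.toComplL (𝕜 := ℂ) (E := PreExtrapolation R)).comp
    ((toPreExtrapolation R).mkContinuous ‖R‖ fun x => by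
      rw [norm_toPreExtrapolation]; exact R.le_opNorm x)

theorem norm_toExtrapolation (R : X →L[ℂ] X) (x : X) : ‖toExtrapolation R x‖ = ‖R x‖ := by
  rw [← norm_toPreExtrapolation]
  exact UniformSpace.Completion.norm_coe _

/-- `Aext : X → X₋₁` is the continuous extension of the restriction `A` of `J` to `ker G`. -/
def IsExtension {Z U : Type*} [NormedAddCommGroup Z] [InnerProductSpace ℂ Z]
    [NormedAddCommGroup U] [InnerProductSpace ℂ U]
    (ι : Z →L[ℂ] X) (J : Z →L[ℂ] X) (G : Z →L[ℂ] U) (R : X →L[ℂ] X)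
    (Aext : X →L[ℂ] Extrapolation R) : Prop :=
  ∀ z : Z, G z = 0 → Aext (ι z) = toExtrapolation R (J z)

/-- `B : U → X₋₁` is a control operator of `(J, G)`: one has `J = A|_X + B G` on `Z`, and
`G (b I - A|_X)⁻¹ B = I` for every `b` in the resolvent set of `A`. -/
structure IsControlOperator {Z U : Type*} [NormedAddCommGroup Z] [InnerProductSpace ℂ Z]
    [NormedAddCommGroup U] [InnerProductSpace ℂ U]
    (ι : Z →L[ℂ] X) (J : Z →L[ℂ] X) (G : Z →L[ℂ] U) (R : X →L[ℂ] X)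
    (Aext : X →L[ℂ] Extrapolation R) (B : U →L[ℂ] Extrapolation R) : Prop where
  eq : ∀ z : Z, toExtrapolation R (J z) = Aext (ι z) + B (G z)
  inverse : ∀ b : ℂ, (∃ Rb : X →L[ℂ] X, IsResolvent ι J G b Rb) →
    ∀ u : U, ∃ z : Z, G z = u ∧
      ∀ x : X, b • toExtrapolation R x - Aext x = B u ↔ x = ι z

/-- The map `(e, u, f) ↦ A|_X e + B u - f`, with values in `X₋₁`. -/
def effortMap {U : Type*} [NormedAddCommGroup U] [InnerProductSpace ℂ U] (R : X →L[ℂ] X)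
    (Aext : X →L[ℂ] Extrapolation R) (B : U →L[ℂ] Extrapolation R) :
    WithLp 2 (WithLp 2 (X × U) × X) →L[ℂ] Extrapolation R :=
  (Aext.comp (WithLp.fstL 2 ℂ X U) + B.comp (WithLp.sndL 2 ℂ X U)).comp
      (WithLp.fstL 2 ℂ (WithLp 2 (X × U)) X)
    - (toExtrapolation R).comp (WithLp.sndL 2 ℂ (WithLp 2 (X × U)) X)

/-- The effort space of all `(e, u)` with `A|_X e + B u ∈ X`, with the graph norm
`‖e‖² + ‖u‖² + ‖A|_X e + B u‖_X²`. A point is stored as `((e, u), f)` with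
`f = A|_X e + B u ∈ X`. -/
abbrev EffortSpace {U : Type*} [NormedAddCommGroup U] [InnerProductSpace ℂ U] (R : X →L[ℂ] X)
    (Aext : X →L[ℂ] Extrapolation R) (B : U →L[ℂ] Extrapolation R) :
    Submodule ℂ (WithLp 2 (WithLp 2 (X × U) × X)) :=
  LinearMap.ker (effortMap R Aext B).toLinearMap

instance {U : Type*} [NormedAddCommGroup U] [InnerProductSpace ℂ U] [CompleteSpace X]
    [CompleteSpace U] (R : X →L[ℂ] X)
    (Aext : X →L[ℂ] Extrapolation R) (B : U →L[ℂ] Extrapolation R) :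
    CompleteSpace (EffortSpace R Aext B) :=
  (effortMap R Aext B).isClosed_ker.completeSpace_coe

end Extrapolation

/-! ### Two-component systems -/

section Block

variable {X₁ X₂ U₁ U₂ : Type*}
  [NormedAddCommGroup X₁] [InnerProductSpace ℂ X₁]
  [NormedAddCommGroup X₂] [InnerProductSpace ℂ X₂]
  [NormedAddCommGroup U₁] [InnerProductSpace ℂ U₁]
  [NormedAddCommGroup U₂] [InnerProductSpace ℂ U₂]

/-- The solution space `Z¹ × Z²`. -/
abbrev SolutionSpace (L : X₁ →ₗ.[ℂ] X₂) (K : X₂ →ₗ.[ℂ] X₁) : Type _ :=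
  WithLp 2 (GraphSpace L × GraphSpace K)

/-- The embedding of `Z¹ × Z²` in `X¹ × X²`. -/
def blockEmb (L : X₁ →ₗ.[ℂ] X₂) (K : X₂ →ₗ.[ℂ] X₁) :
    SolutionSpace L K →L[ℂ] WithLp 2 (X₁ × X₂) :=
  (WithLp.prodContinuousLinearEquiv 2 ℂ X₁ X₂).symm.toContinuousLinearMap.comp
    (((GraphSpace.emb L).comp (WithLp.fstL 2 ℂ _ _)).prod
      ((GraphSpace.emb K).comp (WithLp.sndL 2 ℂ _ _)))

/-- `J (z¹, z²) = (-K z², L z¹)`. -/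
def blockJ (L : X₁ →ₗ.[ℂ] X₂) (K : X₂ →ₗ.[ℂ] X₁) :
    SolutionSpace L K →L[ℂ] WithLp 2 (X₁ × X₂) :=
  (WithLp.prodContinuousLinearEquiv 2 ℂ X₁ X₂).symm.toContinuousLinearMap.comp
    ((-((GraphSpace.op K).comp (WithLp.sndL 2 ℂ _ _))).prod
      ((GraphSpace.op L).comp (WithLp.fstL 2 ℂ _ _)))

/-- `G (z¹, z²) = (γ¹ z¹, γ² z²)`. -/
def blockG {L : X₁ →ₗ.[ℂ] X₂} {K : X₂ →ₗ.[ℂ] X₁}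
    (γ₁ : GraphSpace L →L[ℂ] U₁) (γ₂ : GraphSpace K →L[ℂ] U₂) :
    SolutionSpace L K →L[ℂ] WithLp 2 (U₁ × U₂) :=
  (WithLp.prodContinuousLinearEquiv 2 ℂ U₁ U₂).symm.toContinuousLinearMap.comp
    ((γ₁.comp (WithLp.fstL 2 ℂ _ _)).prod (γ₂.comp (WithLp.sndL 2 ℂ _ _)))

/-- The first component `X¹₋₁` of `X₋₁`: the closure of `X¹ × {0}` in `X₋₁`. -/
abbrev extrapolationFst (R : WithLp 2 (X₁ × X₂) →L[ℂ] WithLp 2 (X₁ × X₂)) :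
    Submodule ℂ (Extrapolation R) :=
  ((LinearMap.ker (WithLp.sndL 2 ℂ X₁ X₂).toLinearMap).map
    (toExtrapolation R).toLinearMap).topologicalClosure

/-- The second component `X²₋₁` of `X₋₁`: the closure of `{0} × X²` in `X₋₁`. -/
abbrev extrapolationSnd (R : WithLp 2 (X₁ × X₂) →L[ℂ] WithLp 2 (X₁ × X₂)) :
    Submodule ℂ (Extrapolation R) :=
  ((LinearMap.ker (WithLp.fstL 2 ℂ X₁ X₂).toLinearMap).map
    (toExtrapolation R).toLinearMap).topologicalClosure

/-- `B (u¹, u²) = (B² u², B¹ u¹)`, as an element of `X₋₁ = X¹₋₁ ⊕ X²₋₁`. -/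
def blockB {R : WithLp 2 (X₁ × X₂) →L[ℂ] WithLp 2 (X₁ × X₂)}
    (B₁ : U₁ →L[ℂ] extrapolationSnd R) (B₂ : U₂ →L[ℂ] extrapolationFst R) :
    WithLp 2 (U₁ × U₂) →L[ℂ] Extrapolation R :=
  ((extrapolationSnd R).subtypeL.comp B₁).comp (WithLp.fstL 2 ℂ U₁ U₂)
    + ((extrapolationFst R).subtypeL.comp B₂).comp (WithLp.sndL 2 ℂ U₁ U₂)

/-- The operator `T` from the effort space to its dual is the operator with block form
`[[A|_X, B], [-C, 0]]`, where `C (z¹, z²) = (β² z², β¹ z¹)`: if `(e, u)` is an effort, `e` lies in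
`Z¹ × Z²` and `u = G e`, and `T (e, u)` is the linear form
`(x, v) ↦ (A|_X e + B u, x)_X - ⟨β² e², v¹⟩ - ⟨β¹ e¹, v²⟩`. -/
def IsExtendedStructureOperator {L : X₁ →ₗ.[ℂ] X₂} {K : X₂ →ₗ.[ℂ] X₁}
    (γ₁ : GraphSpace L →L[ℂ] U₁) (γ₂ : GraphSpace K →L[ℂ] U₂)
    (β₁ : GraphSpace L →L⋆[ℂ] StrongDual ℂ U₂) (β₂ : GraphSpace K →L⋆[ℂ] StrongDual ℂ U₁)
    (R : WithLp 2 (X₁ × X₂) →L[ℂ] WithLp 2 (X₁ × X₂))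
    (Aext : WithLp 2 (X₁ × X₂) →L[ℂ] Extrapolation R)
    (B : WithLp 2 (U₁ × U₂) →L[ℂ] Extrapolation R)
    (T : EffortSpace R Aext B →L⋆[ℂ] StrongDual ℂ (EffortSpace R Aext B)) : Prop :=
  ∀ p : EffortSpace R Aext B, ∃ z : SolutionSpace L K,
    blockEmb L K z = p.1.fst.fst ∧ blockG γ₁ γ₂ z = p.1.fst.snd ∧
    ∀ q : EffortSpace R Aext B,
      T p q = ⟪p.1.snd, q.1.fst.fst⟫_ℂ
        - (β₂ z.snd q.1.fst.snd.fst + β₁ z.fst q.1.fst.snd.snd)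

end Block

end PortHamiltonian

end

open PortHamiltonian

namespace PortHamiltonian

/-! ### The extrapolation space of an abstract boundary control system -/

section Abstract

variable {Z X U : Type*}
  [NormedAddCommGroup Z] [InnerProductSpace ℂ Z]
  [NormedAddCommGroup X] [InnerProductSpace ℂ X]
  [NormedAddCommGroup U] [InnerProductSpace ℂ U]
  {ι : Z →L[ℂ] X} {J : Z →L[ℂ] X} {G : Z →L[ℂ] U} {R : X →L[ℂ] X}
  {Aext : X →L[ℂ] Extrapolation R} {B : U →L[ℂ] Extrapolation R}

/-! On `ker G` every boundary term of the Green identity vanishes, so `A` is skew-symmetric and `‖(I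
- A) z‖² = ‖z‖² + ‖A z‖²`. This makes `I - A` injective, with an inverse of norm at most one on its
range. That the range is everything is von Neumann's argument: the orthogonal complement of the
graph of `L` on `ker γ₁` is described by the adjoint, and assumption (a) makes this adjoint a
restriction of `K` to `ker γ₂` (`GreenIdentity.adjointLe`, `AdjointLe.exists_decomposition`).
Assumption (b) is the same after exchanging the two components.

The rest of the control theory needs only the resolvent at `1`. The operator `J - A|_X` vanishes on
`ker G`, so it factors through the surjection `G`, and the factor is `B`; conversely `A|_X e + B u ∈
X` forces `e` to come from `Z` (`IsExtension.exists_of_effort`). The splitting of `X₋₁` holds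
because the reflection `(x¹, x²) ↦ (x¹, -x²)` turns `A` into `-A`, and skewness makes the resolvent
norms at `1` of both equal.

Finally, the Green identity with its boundary terms says that the form of the structure operator is
skew on all of `Z`, and an everywhere defined skew operator has a graph equal to its own companion.
-/

theorem IsResolvent.unique {b : ℂ} {R' : X →L[ℂ] X} (h : IsResolvent ι J G b R)
    (h' : IsResolvent ι J G b R') : R' = R := by
  ext x
  obtain ⟨z, hz, hzx, rfl⟩ := h'.right_inv x
  rw [h.left_inv z hz, ← hzx]

theorem IsResolvent.toExtrapolation_injective (h : IsResolvent ι J G 1 R)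
    (hι : Function.Injective ι) : Function.Injective (toExtrapolation R) := by
  refine (injective_iff_map_eq_zero _).2 fun x hx => ?_
  have hR : R x = 0 := by rw [← norm_eq_zero, ← norm_toExtrapolation, hx, norm_zero]
  obtain ⟨z, -, hzx, rfl⟩ := h.right_inv x
  have hz : z = 0 := hι (by rw [hzx, hR, map_zero])
  simp [hz]

theorem denseRange_toExtrapolation (R : X →L[ℂ] X) : DenseRange (toExtrapolation R) :=
  UniformSpace.Completion.denseRange_coe (α := PreExtrapolation R)

/-- Universal property of the completion. It is applied to `R` itself and to the projection on the
first component. -/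
theorem exists_extension_extrapolation {F : Type*} [NormedAddCommGroup F] [NormedSpace ℂ F]
    [CompleteSpace F] (f : X →ₗ[ℂ] F) (C : ℝ) (hf : ∀ x, ‖f x‖ ≤ C * ‖R x‖) :
    ∃ g : Extrapolation R →L[ℂ] F, ∀ x, g (toExtrapolation R x) = f x :=
  ⟨f.extendOfNorm (toExtrapolation R).toLinearMap, fun x =>
    LinearMap.extendOfNorm_eq (e := (toExtrapolation R).toLinearMap)
      (denseRange_toExtrapolation R)
      ⟨C, fun x => by simpa [norm_toExtrapolation] using hf x⟩ x⟩

theorem IsExtension.unique {Aext' : X →L[ℂ] Extrapolation R} (hd : Dense (ι '' {z | G z = 0}))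
    (h : IsExtension ι J G R Aext) (h' : IsExtension ι J G R Aext') : Aext' = Aext := by
  refine ContinuousLinearMap.coeFn_injective
    (Continuous.ext_on hd Aext'.continuous Aext.continuous ?_)
  rintro _ ⟨z, hz, rfl⟩
  rw [h z hz, h' z hz]

/-- From `R (I - A) = I` follows `R A = R - I` on `ker G`, so `A` is bounded from the norm of `X` to
the norm `‖R ·‖`. -/
theorem IsResolvent.exists_isExtension (h : IsResolvent ι J G 1 R)
    (hd : Dense (ι '' {z | G z = 0})) :
    ∃ Aext : X →L[ℂ] Extrapolation R, IsExtension ι J G R Aext := by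
  let e : LinearMap.ker G.toLinearMap →ₗ[ℂ] X := ι.toLinearMap ∘ₗ Submodule.subtype _
  let f : LinearMap.ker G.toLinearMap →ₗ[ℂ] Extrapolation R :=
    (toExtrapolation R).toLinearMap ∘ₗ J.toLinearMap ∘ₗ Submodule.subtype _
  have he : DenseRange e := by
    refine hd.mono ?_
    rintro _ ⟨z, hz, rfl⟩
    exact ⟨⟨z, hz⟩, rfl⟩
  refine ⟨f.extendOfNorm e, fun z hz => ?_⟩
  refine LinearMap.extendOfNorm_eq (f := f) (e := e) he ⟨‖R‖ + 1, ?_⟩ ⟨z, hz⟩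
  rintro ⟨z, hz⟩
  have hz' : G z = 0 := hz
  change ‖toExtrapolation R (J z)‖ ≤ (‖R‖ + 1) * ‖ι z‖
  have key : R (J z) = R (ι z) - ι z := by
    have := h.left_inv z hz'
    rw [one_smul, map_sub] at this
    rw [eq_sub_iff_add_eq', ← eq_sub_iff_add_eq]
    exact this.symm
  rw [norm_toExtrapolation, key, add_mul, one_mul]
  exact (norm_sub_le _ _).trans (by gcongr; exact R.le_opNorm _)

/-- The extension `A|_X` takes values in `X` only on the domain of `A`. Indeed `R` extends to `V` on
`X₋₁`, and `V A|_X = R - I` by density, so `A|_X x = f` gives `x = R (x - f)`, which lies in the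
range of the resolvent. -/
theorem IsExtension.exists_of_eq [CompleteSpace X] (hA : IsExtension ι J G R Aext)
    (h : IsResolvent ι J G 1 R) (hι : Function.Injective ι) (hd : Dense (ι '' {z | G z = 0}))
    {x f : X} (hx : Aext x = toExtrapolation R f) : ∃ z, G z = 0 ∧ ι z = x ∧ J z = f := by
  obtain ⟨V, hV⟩ := exists_extension_extrapolation (R := R) R.toLinearMap 1 (by simp)
  have hVA : ∀ y, V (Aext y) = R y - y := by
    refine fun y => congrFun (Continuous.ext_on hd (f := fun y => V (Aext y))
      (g := fun y => R y - y) (by fun_prop) (by fun_prop) ?_) y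
    rintro _ ⟨z, hz, rfl⟩
    have := h.left_inv z hz
    rw [one_smul, map_sub] at this
    simp only [hA z hz, hV, ContinuousLinearMap.coe_coe]
    rw [eq_sub_iff_add_eq', ← eq_sub_iff_add_eq]
    exact this.symm
  have hR : R (x - f) = x := by
    have := hVA x
    rw [hx, hV, ContinuousLinearMap.coe_coe] at this
    rw [map_sub, this]; abel
  obtain ⟨z, hz, hzx, -⟩ := h.right_inv (x - f)
  rw [hR] at hzx
  refine ⟨z, hz, hzx, h.toExtrapolation_injective hι ?_⟩
  rw [← hA z hz, hzx, hx]

theorem IsExtension.exists_control [CompleteSpace Z] [CompleteSpace U]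
    (hA : IsExtension ι J G R Aext) (hG : Function.Surjective G) :
    ∃ B : U →L[ℂ] Extrapolation R, ∀ z, toExtrapolation R (J z) = Aext (ι z) + B (G z) := by
  let D : Z →L[ℂ] Extrapolation R := (toExtrapolation R).comp J - Aext.comp ι
  have hD : ∀ z z', G z = G z' → D z = D z' := fun z z' hz => by
    have h0 : G (z - z') = 0 := by rw [map_sub, hz, sub_self]
    rw [← sub_eq_zero, ← map_sub]
    exact sub_eq_zero.2 (hA _ h0).symm
  -- Open mapping: lifts through `G` with norm control. The lift need not be linear, since `D` does
  -- not see the choice.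
  obtain ⟨C, -, hC⟩ := ContinuousLinearMap.exists_preimage_norm_le G hG
  choose g hg hgn using hC
  let B₀ : U →ₗ[ℂ] Extrapolation R :=
    { toFun := fun u => D (g u)
      map_add' := fun u v => by rw [← map_add]; exact hD _ _ (by simp [hg])
      map_smul' := fun c u => by
        rw [RingHom.id_apply, ← map_smul]; exact hD _ _ (by simp [hg]) }
  refine ⟨B₀.mkContinuous (‖D‖ * C) fun u => ?_, fun z => ?_⟩
  · refine (D.le_opNorm (g u)).trans ?_
    rw [mul_assoc]
    gcongr
    exact hgn u
  · have : D (g (G z)) = D z := hD _ _ (hg _)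
    change _ = _ + D (g (G z))
    rw [this]
    simp [D]

theorem IsExtension.exists_of_effort [CompleteSpace X] (hA : IsExtension ι J G R Aext)
    (h : IsResolvent ι J G 1 R) (hι : Function.Injective ι) (hG : Function.Surjective G)
    (hd : Dense (ι '' {z | G z = 0}))
    (hB : ∀ z, toExtrapolation R (J z) = Aext (ι z) + B (G z)) {x f : X} {u : U}
    (hx : Aext x + B u = toExtrapolation R f) : ∃ z, ι z = x ∧ G z = u ∧ J z = f := by
  obtain ⟨z₀, rfl⟩ := hG u
  -- Subtracting a lift of `u` removes the control term.
  obtain ⟨z, hz, hzx, hzf⟩ := hA.exists_of_eq h hι hd (x := x - ι z₀) (f := f - J z₀) (by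
    rw [map_sub, map_sub, ← hx, hB]; abel)
  exact ⟨z + z₀, by simp [hzx], by simp [hz], by simp [hzf]⟩

theorem IsExtension.isControlOperator [CompleteSpace X] (hA : IsExtension ι J G R Aext)
    (h : IsResolvent ι J G 1 R) (hι : Function.Injective ι) (hG : Function.Surjective G)
    (hd : Dense (ι '' {z | G z = 0}))
    (hB : ∀ z, toExtrapolation R (J z) = Aext (ι z) + B (G z)) :
    IsControlOperator ι J G R Aext B := by
  refine ⟨hB, ?_⟩
  rintro b ⟨Rb, hRb⟩ u
  obtain ⟨z₀, rfl⟩ := hG u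
  -- Correct the lift by an element of `ker G` to obtain a solution of `J z = b z` with `G z = u`.
  obtain ⟨w, hw, -, hwb⟩ := hRb.right_inv (J z₀ - b • ι z₀)
  have hz : b • ι (z₀ + w) = J (z₀ + w) := by
    rw [map_add, map_add, smul_add, ← sub_eq_zero]
    rw [← sub_eq_zero] at hwb
    rw [← hwb]; abel
  refine ⟨z₀ + w, by simp [hw], fun x => ⟨fun hx => ?_, ?_⟩⟩
  -- A solution `x` satisfies `A|_X x + B u = b x ∈ X`, hence lifts to `Z`; its difference with `z₀
  -- + w` is an element of `ker G` annihilated by `b I - A`.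
  · obtain ⟨y, hyx, hyG, hyJ⟩ := hA.exists_of_effort h hι hG hd hB (x := x) (u := G z₀)
      (f := b • x) (by rw [← hx, map_smul]; abel)
    have h0 : G (y - (z₀ + w)) = 0 := by simp [hyG, hw]
    have := hRb.left_inv _ h0
    rw [map_sub ι, map_sub J, smul_sub, hz, hyJ, hyx, sub_self, map_zero] at this
    exact (sub_eq_zero.1 this.symm)
  · rintro rfl
    rw [← map_smul, hz, hB]
    simp [hw]

theorem control_unique {B' : U →L[ℂ] Extrapolation R} (hG : Function.Surjective G)
    (hB : ∀ z, toExtrapolation R (J z) = Aext (ι z) + B (G z))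
    (hB' : ∀ z, toExtrapolation R (J z) = Aext (ι z) + B' (G z)) : B' = B := by
  ext u
  obtain ⟨z, rfl⟩ := hG u
  exact add_left_cancel ((hB' z).symm.trans (hB z))

theorem mem_effortSpace {p : WithLp 2 (WithLp 2 (X × U) × X)} :
    p ∈ EffortSpace R Aext B ↔
      Aext p.fst.fst + B p.fst.snd = toExtrapolation R p.snd :=
  sub_eq_zero

/-- The effort space is isomorphic to the solution space. -/
theorem IsExtension.exists_effortSolution [CompleteSpace Z] [CompleteSpace X] [CompleteSpace U]
    (hA : IsExtension ι J G R Aext)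
    (h : IsResolvent ι J G 1 R) (hι : Function.Injective ι) (hG : Function.Surjective G)
    (hd : Dense (ι '' {z | G z = 0}))
    (hB : ∀ z, toExtrapolation R (J z) = Aext (ι z) + B (G z)) :
    ∃ Φ : EffortSpace R Aext B →L[ℂ] Z,
      ∀ p, ι (Φ p) = p.1.fst.fst ∧ G (Φ p) = p.1.fst.snd ∧ J (Φ p) = p.1.snd := by
  let Ψ₀ : Z →L[ℂ] WithLp 2 (WithLp 2 (X × U) × X) :=
    (WithLp.prodContinuousLinearEquiv 2 ℂ _ _).symm.toContinuousLinearMap.comp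
      (((WithLp.prodContinuousLinearEquiv 2 ℂ _ _).symm.toContinuousLinearMap.comp
        (ι.prod G)).prod J)
  let Ψ : Z →L[ℂ] EffortSpace R Aext B :=
    Ψ₀.codRestrict _ fun z => mem_effortSpace.2 (hB z).symm
  have hinj : LinearMap.ker Ψ.toLinearMap = ⊥ := by
    refine LinearMap.ker_eq_bot.2 fun z z' hz => hι ?_
    exact congrArg (fun p : EffortSpace R Aext B => p.1.fst.fst) hz
  have hsurj : LinearMap.range Ψ.toLinearMap = ⊤ := by
    refine LinearMap.range_eq_top.2 fun p => ?_
    obtain ⟨z, h1, h2, h3⟩ := hA.exists_of_effort h hι hG hd hB (mem_effortSpace.1 p.2)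
    refine ⟨z, Subtype.ext ?_⟩
    change WithLp.toLp 2 (WithLp.toLp 2 (ι z, G z), J z) = p.1
    rw [h1, h2, h3]
    rfl
  -- The inverse is bounded by the open mapping theorem, both spaces being complete.
  let e := ContinuousLinearEquiv.ofBijective Ψ hinj hsurj
  refine ⟨e.symm.toContinuousLinearMap, fun p => ?_⟩
  have hp : Ψ (e.symm p) = p := e.apply_symm_apply p
  exact ⟨congrArg (fun p : EffortSpace R Aext B => p.1.fst.fst) hp,
    congrArg (fun p : EffortSpace R Aext B => p.1.fst.snd) hp,
    congrArg (fun p : EffortSpace R Aext B => p.1.snd) hp⟩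

end Abstract

/-! ### Skew-symmetric operators and Stokes-Dirac structures -/

/-- Skewness is isotropy of the graph. Maximality comes from `T` being defined on all of `E`:
testing against every `(T q, q)` determines `f` on every `q`. -/
theorem isStokesDirac_dualGraph {E : Type*} [NormedAddCommGroup E] [InnerProductSpace ℂ E]
    [CompleteSpace E] (T : E →L⋆[ℂ] StrongDual ℂ E)
    (hT : ∀ p q, conj (T p q) + T q p = 0) : IsStokesDirac (dualGraph T) := by
  ext ⟨f, p⟩
  constructor
  · intro h
    refine ContinuousLinearMap.ext fun q => (starRingEnd ℂ).injective ?_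
    have h1 : conj (f q) + T q p = 0 := h (T q, q) rfl
    exact add_right_cancel (h1.trans (hT p q).symm)
  · rintro (rfl : f = T p) ⟨g, q⟩ (rfl : g = T q)
    exact hT p q

end PortHamiltonian

namespace PortHamiltonian

/-! ### Graph spaces -/

section Graph

variable {X Y : Type*} [NormedAddCommGroup X] [InnerProductSpace ℂ X]
  [NormedAddCommGroup Y] [InnerProductSpace ℂ Y] {T : X →ₗ.[ℂ] Y}

theorem completeSpace_graphSpace [CompleteSpace X] [CompleteSpace Y] (hT : T.IsClosed) :
    CompleteSpace (GraphSpace T) :=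
  IsClosed.completeSpace_coe
    (hs := hT.preimage (WithLp.prodContinuousLinearEquiv 2 ℂ X Y).continuous)

theorem GraphSpace.emb_injective : Function.Injective (GraphSpace.emb T) := by
  intro z z' h
  have h2 : GraphSpace.op T z = GraphSpace.op T z' := LinearPMap.mem_graph_snd_inj T z.2 z'.2 h
  refine Subtype.ext ?_
  change WithLp.toLp 2 (GraphSpace.emb T z, GraphSpace.op T z)
    = WithLp.toLp 2 (GraphSpace.emb T z', GraphSpace.op T z')
  rw [h, h2]

theorem GraphSpace.exists_emb_eq {x : X} (hx : x ∈ T.domain) : ∃ z, GraphSpace.emb T z = x :=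
  ⟨⟨WithLp.toLp 2 (x, T ⟨x, hx⟩), T.mem_graph ⟨x, hx⟩⟩, rfl⟩

end Graph

/-! ### The Green identity, adjoints, and the range of `I - A` -/

section Green

variable {X₁ X₂ U₁ U₂ : Type*}
  [NormedAddCommGroup X₁] [InnerProductSpace ℂ X₁]
  [NormedAddCommGroup X₂] [InnerProductSpace ℂ X₂]
  [NormedAddCommGroup U₁] [InnerProductSpace ℂ U₁]
  [NormedAddCommGroup U₂] [InnerProductSpace ℂ U₂]
  {L : X₁ →ₗ.[ℂ] X₂} {K : X₂ →ₗ.[ℂ] X₁}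

/-- The abstract Green identity. -/
def GreenIdentity (L : X₁ →ₗ.[ℂ] X₂) (K : X₂ →ₗ.[ℂ] X₁)
    (γ₁ : GraphSpace L →L[ℂ] U₁) (γ₂ : GraphSpace K →L[ℂ] U₂)
    (β₁ : GraphSpace L →L⋆[ℂ] StrongDual ℂ U₂) (β₂ : GraphSpace K →L⋆[ℂ] StrongDual ℂ U₁) : Prop :=
  ∀ (z₁ : GraphSpace L) (z₂ : GraphSpace K),
    ⟪GraphSpace.op L z₁, GraphSpace.emb K z₂⟫_ℂ
      = ⟪GraphSpace.emb L z₁, GraphSpace.op K z₂⟫_ℂ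
        + conj (β₂ z₂ (γ₁ z₁)) + β₁ z₁ (γ₂ z₂)

/-- The adjoint of `L|ker γ₁` is a restriction of `K|ker γ₂`. -/
def AdjointLe (L : X₁ →ₗ.[ℂ] X₂) (K : X₂ →ₗ.[ℂ] X₁)
    (γ₁ : GraphSpace L →L[ℂ] U₁) (γ₂ : GraphSpace K →L[ℂ] U₂) : Prop :=
  ∀ (v : X₂) (w : X₁),
    (∀ z, γ₁ z = 0 → ⟪GraphSpace.op L z, v⟫_ℂ = ⟪GraphSpace.emb L z, w⟫_ℂ) →
    ∃ z, γ₂ z = 0 ∧ GraphSpace.emb K z = v ∧ GraphSpace.op K z = w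

variable {γ₁ : GraphSpace L →L[ℂ] U₁} {γ₂ : GraphSpace K →L[ℂ] U₂}
  {β₁ : GraphSpace L →L⋆[ℂ] StrongDual ℂ U₂} {β₂ : GraphSpace K →L⋆[ℂ] StrongDual ℂ U₁}

/-- Conjugation exchanges the roles of the components; the minus signs come from moving the boundary
terms to the other side. This reduces assumption (b) to (a). -/
theorem GreenIdentity.swap (h : GreenIdentity L K γ₁ γ₂ β₁ β₂) :
    GreenIdentity K L γ₂ γ₁ (-β₂) (-β₁) := by
  intro z₂ z₁
  have := congrArg conj (h z₁ z₂)
  simp only [map_add, inner_conj_symm, Complex.conj_conj] at this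
  simp only [neg_apply, map_neg, this]
  ring

/-- Maximality puts `v` in the domain of `K`. Testing where both traces vanish identifies `K v` with
`w` by density; testing on `ker γ₁` then leaves only the term pairing `β₁ y` with `γ₂ z`, and
surjectivity of `β₁` there gives `γ₂ z = 0`. -/
theorem GreenIdentity.adjointLe (h : GreenIdentity L K γ₁ γ₂ β₁ β₂)
    (hd : Dense (GraphSpace.emb L '' {z | γ₁ z = 0 ∧ β₁ z = 0}))
    (hβ : ∀ g : StrongDual ℂ U₂, ∃ z, γ₁ z = 0 ∧ β₁ z = g)
    (hmax : ∀ (v : X₂) (w : X₁),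
      (∀ z : GraphSpace L, γ₁ z = 0 → β₁ z = 0 →
        ⟪GraphSpace.op L z, v⟫_ℂ = ⟪GraphSpace.emb L z, w⟫_ℂ) → v ∈ K.domain) :
    AdjointLe L K γ₁ γ₂ := by
  intro v w hvw
  obtain ⟨z, rfl⟩ := GraphSpace.exists_emb_eq (hmax v w fun z hz _ => hvw z hz)
  have hw : GraphSpace.op K z = w := by
    refine hd.eq_of_inner_right (𝕜 := ℂ) ?_
    rintro _ ⟨y, ⟨hy, hy'⟩, rfl⟩
    have := h y z
    rw [hvw y hy, hy, hy'] at this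
    simpa using this.symm
  refine ⟨z, ?_, rfl, hw⟩
  -- With the Riesz form of `γ₂ z` as `β₁ y`, the remaining boundary term is `‖γ₂ z‖²`.
  obtain ⟨y, hy, hy'⟩ := hβ (innerSL ℂ (γ₂ z))
  have := h y z
  rw [hvw y hy, hy, hy', hw] at this
  simpa using this

/-- Von Neumann's argument: split `(x₁, -x₂)` orthogonally along the closed graph `M` of `L` on `ker
γ₁`. A pair `(w, -v)` is orthogonal to `M` exactly when `v` is in the domain of the adjoint with
value `w`, and `h` then supplies `z₂`. -/
theorem AdjointLe.exists_decomposition [CompleteSpace X₁] [CompleteSpace X₂] (hL : L.IsClosed)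
    (h : AdjointLe L K γ₁ γ₂) (x₁ : X₁) (x₂ : X₂) :
    ∃ z₁ z₂, γ₁ z₁ = 0 ∧ γ₂ z₂ = 0 ∧ GraphSpace.emb L z₁ + GraphSpace.op K z₂ = x₁ ∧
      GraphSpace.emb K z₂ - GraphSpace.op L z₁ = x₂ := by
  have := completeSpace_graphSpace hL
  let M : Submodule ℂ (WithLp 2 (X₁ × X₂)) :=
    (LinearMap.ker γ₁.toLinearMap).map (GraphSpace L).subtype
  have hM : IsComplete (M : Set (WithLp 2 (X₁ × X₂))) :=
    (isComplete_image_iff (GraphSpace L).subtypeₗᵢ.isometry.isUniformInducing).2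
      γ₁.isClosed_ker.isComplete
  have : CompleteSpace M := hM.completeSpace_coe
  obtain ⟨_, ⟨z, hz, rfl⟩, y, hy, hxy⟩ :=
    M.exists_add_mem_mem_orthogonal (WithLp.toLp 2 (x₁, -x₂))
  have hz' : γ₁ z = 0 := hz
  obtain ⟨z₂, h0, h1, h2⟩ := h (-y.snd) y.fst (fun a ha => by
    have : ⟪(a : WithLp 2 (X₁ × X₂)), y⟫_ℂ = 0 := hy _ ⟨a, ha, rfl⟩
    rw [WithLp.prod_inner_apply] at this
    rw [inner_neg_right, eq_comm, eq_neg_iff_add_eq_zero]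
    exact this)
  have e1 : x₁ = GraphSpace.emb L z + y.fst := congrArg WithLp.fst hxy
  have e2 : -x₂ = GraphSpace.op L z + y.snd := congrArg WithLp.snd hxy
  refine ⟨z, z₂, hz', h0, by rw [h2, e1], ?_⟩
  rw [h1, ← neg_inj, e2]; abel

theorem AdjointLe.exists_decomposition' [CompleteSpace X₁] [CompleteSpace X₂] (hK : K.IsClosed)
    (h : AdjointLe K L γ₂ γ₁) (x₁ : X₁) (x₂ : X₂) :
    ∃ z₁ z₂, γ₁ z₁ = 0 ∧ γ₂ z₂ = 0 ∧ GraphSpace.emb L z₁ + GraphSpace.op K z₂ = x₁ ∧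
      GraphSpace.emb K z₂ - GraphSpace.op L z₁ = x₂ := by
  -- The exchanged system has the opposite signs off the diagonal, hence the data `(-x₂, x₁)` and
  -- the solution `-z₂`.
  obtain ⟨z₂, z₁, h2, h1, e2, e1⟩ := h.exists_decomposition hK (-x₂) x₁
  refine ⟨z₁, -z₂, h1, by simp [h2], ?_, ?_⟩
  · rw [map_neg, ← e1]; abel
  · rw [map_neg, ← neg_inj, ← e2]; abel

end Green

/-! ### The block system -/

section System

variable {X₁ X₂ U₁ U₂ : Type*}
  [NormedAddCommGroup X₁] [InnerProductSpace ℂ X₁]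
  [NormedAddCommGroup X₂] [InnerProductSpace ℂ X₂]
  [NormedAddCommGroup U₁] [InnerProductSpace ℂ U₁]
  [NormedAddCommGroup U₂] [InnerProductSpace ℂ U₂]
  {L : X₁ →ₗ.[ℂ] X₂} {K : X₂ →ₗ.[ℂ] X₁}
  {γ₁ : GraphSpace L →L[ℂ] U₁} {γ₂ : GraphSpace K →L[ℂ] U₂}
  {β₁ : GraphSpace L →L⋆[ℂ] StrongDual ℂ U₂} {β₂ : GraphSpace K →L⋆[ℂ] StrongDual ℂ U₁}
  {R : WithLp 2 (X₁ × X₂) →L[ℂ] WithLp 2 (X₁ × X₂)}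
  {Aext : WithLp 2 (X₁ × X₂) →L[ℂ] Extrapolation R}

theorem blockEmb_apply (z : SolutionSpace L K) :
    blockEmb L K z = WithLp.toLp 2 (GraphSpace.emb L z.fst, GraphSpace.emb K z.snd) := rfl

theorem blockJ_apply (z : SolutionSpace L K) :
    blockJ L K z = WithLp.toLp 2 (-GraphSpace.op K z.snd, GraphSpace.op L z.fst) := rfl

theorem blockG_apply (z : SolutionSpace L K) :
    blockG γ₁ γ₂ z = WithLp.toLp 2 (γ₁ z.fst, γ₂ z.snd) := rfl

theorem toLp_prod_eq {V W : Type*} {a c : V} {b d : W} :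
    WithLp.toLp 2 (a, b) = WithLp.toLp 2 (c, d) ↔ a = c ∧ b = d := by
  simp

theorem blockG_eq_zero {z : SolutionSpace L K} :
    blockG γ₁ γ₂ z = 0 ↔ γ₁ z.fst = 0 ∧ γ₂ z.snd = 0 := by
  rw [blockG_apply]
  exact toLp_prod_eq (c := (0 : U₁)) (d := (0 : U₂))

theorem blockEmb_injective : Function.Injective (blockEmb L K) := by
  rintro ⟨z₁, z₂⟩ ⟨w₁, w₂⟩ h
  rw [blockEmb_apply, blockEmb_apply, toLp_prod_eq] at h
  exact toLp_prod_eq.2 ⟨GraphSpace.emb_injective h.1, GraphSpace.emb_injective h.2⟩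

theorem blockG_surjective (hγ₁ : Function.Surjective γ₁) (hγ₂ : Function.Surjective γ₂) :
    Function.Surjective (blockG γ₁ γ₂) := by
  rintro ⟨u₁, u₂⟩
  obtain ⟨z₁, rfl⟩ := hγ₁ u₁
  obtain ⟨z₂, rfl⟩ := hγ₂ u₂
  exact ⟨WithLp.toLp 2 (z₁, z₂), rfl⟩

theorem dense_blockEmb_ker (h₁ : Dense (GraphSpace.emb L '' {z | γ₁ z = 0}))
    (h₂ : Dense (GraphSpace.emb K '' {z | γ₂ z = 0})) :
    Dense (blockEmb L K '' {z | blockG γ₁ γ₂ z = 0}) := by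
  have := (WithLp.prodContinuousLinearEquiv 2 ℂ X₁ X₂).symm.surjective.denseRange.dense_image
    (WithLp.prodContinuousLinearEquiv 2 ℂ X₁ X₂).symm.continuous (h₁.prod h₂)
  refine this.mono ?_
  rintro _ ⟨⟨_, _⟩, ⟨⟨z₁, hz₁, rfl⟩, ⟨z₂, hz₂, rfl⟩⟩, rfl⟩
  exact ⟨WithLp.toLp 2 (z₁, z₂), blockG_eq_zero.2 ⟨hz₁, hz₂⟩, rfl⟩

/-- Without boundary terms, `(L z₁, z₂)` is the conjugate of `(K z₂, z₁)`, so the two summands have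
cancelling real parts. -/
theorem GreenIdentity.re_inner_blockJ (h : GreenIdentity L K γ₁ γ₂ β₁ β₂) {z : SolutionSpace L K}
    (hz : blockG γ₁ γ₂ z = 0) : (⟪blockJ L K z, blockEmb L K z⟫_ℂ).re = 0 := by
  rw [blockG_eq_zero] at hz
  have := h z.fst z.snd
  rw [hz.1, hz.2, map_zero, map_zero, map_zero, add_zero, add_zero] at this
  rw [WithLp.prod_inner_apply]
  change (⟪-GraphSpace.op K z.snd, GraphSpace.emb L z.fst⟫_ℂ
    + ⟪GraphSpace.op L z.fst, GraphSpace.emb K z.snd⟫_ℂ).re = 0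
  rw [this, inner_neg_left, ← inner_conj_symm]
  simp only [Complex.add_re, Complex.neg_re, Complex.conj_re, neg_add_cancel]

/-- `A` is skew-symmetric, so `‖(I - A) z‖² = ‖z‖² + ‖A z‖²`. -/
theorem GreenIdentity.norm_sq_eq (h : GreenIdentity L K γ₁ γ₂ β₁ β₂) {z : SolutionSpace L K}
    (hz : blockG γ₁ γ₂ z = 0) :
    ‖blockEmb L K z - blockJ L K z‖ ^ 2 = ‖blockEmb L K z‖ ^ 2 + ‖blockJ L K z‖ ^ 2 := by
  have h0 := h.re_inner_blockJ hz
  rw [@norm_sub_sq ℂ, ← inner_re_symm, RCLike.re_eq_complex_re, h0]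
  ring

theorem GreenIdentity.norm_le (h : GreenIdentity L K γ₁ γ₂ β₁ β₂) {z : SolutionSpace L K}
    (hz : blockG γ₁ γ₂ z = 0) : ‖blockEmb L K z‖ ≤ ‖blockEmb L K z - blockJ L K z‖ := by
  refine le_of_sq_le_sq ?_ (norm_nonneg _)
  rw [h.norm_sq_eq hz]
  exact le_add_of_nonneg_right (sq_nonneg _)

theorem GreenIdentity.exists_isResolvent (h : GreenIdentity L K γ₁ γ₂ β₁ β₂)
    (hs : ∀ x, ∃ z, blockG γ₁ γ₂ z = 0 ∧ blockEmb L K z - blockJ L K z = x) :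
    ∃ R, IsResolvent (blockEmb L K) (blockJ L K) (blockG γ₁ γ₂) 1 R := by
  have huniq : ∀ z z', blockG γ₁ γ₂ z = 0 → blockG γ₁ γ₂ z' = 0 →
      blockEmb L K z - blockJ L K z = blockEmb L K z' - blockJ L K z' → z = z' := by
    intro z z' hz hz' hzz
    refine blockEmb_injective ?_
    have := h.norm_le (z := z - z') (by rw [map_sub, hz, hz', sub_zero])
    rw [map_sub, map_sub, sub_sub_sub_comm, hzz, sub_self, norm_zero] at this
    exact sub_eq_zero.1 (norm_le_zero_iff.1 this)
  choose g hg hgx using hs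
  let R₀ : WithLp 2 (X₁ × X₂) →ₗ[ℂ] WithLp 2 (X₁ × X₂) :=
    { toFun := fun x => blockEmb L K (g x)
      map_add' := fun x y => by
        rw [← map_add]
        congr 1
        refine huniq _ _ (hg _) (by rw [map_add, hg, hg, add_zero]) ?_
        rw [map_add, map_add, add_sub_add_comm, hgx, hgx, hgx]
      map_smul' := fun c x => by
        rw [RingHom.id_apply, ← map_smul]
        congr 1
        refine huniq _ _ (hg _) (by rw [map_smul, hg, smul_zero]) ?_
        rw [map_smul, map_smul, ← smul_sub, hgx, hgx] }
  refine ⟨R₀.mkContinuous 1 fun x => ?_, ⟨fun z hz => ?_, fun x => ⟨g x, hg x, rfl, ?_⟩⟩⟩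
  · rw [one_mul]
    exact (h.norm_le (hg x)).trans_eq (by rw [hgx])
  · exact congrArg (blockEmb L K) (huniq _ _ (hg _) hz (by rw [hgx, one_smul]))
  · rw [one_smul, hgx]

/-- The reflection `(x¹, x²) ↦ (x¹, -x²)` is an isometry for the extrapolation norm. -/
theorem GreenIdentity.norm_resolvent_reflect (h : GreenIdentity L K γ₁ γ₂ β₁ β₂)
    (hR : IsResolvent (blockEmb L K) (blockJ L K) (blockG γ₁ γ₂) 1 R) (x₁ : X₁) (x₂ : X₂) :
    ‖R (WithLp.toLp 2 (x₁, -x₂))‖ = ‖R (WithLp.toLp 2 (x₁, x₂))‖ := by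
  obtain ⟨z, hz, hzR, hzx⟩ := hR.right_inv (WithLp.toLp 2 (x₁, x₂))
  obtain ⟨y, hy, hyR, hyx⟩ := hR.right_inv (WithLp.toLp 2 (x₁, -x₂))
  -- The reflection anticommutes with `A`, so the reflected solution satisfies `(I + A) w = x`,
  -- while `(I - A) z = x`.
  let w : SolutionSpace L K := WithLp.toLp 2 (y.fst, -y.snd)
  have hw : blockG γ₁ γ₂ w = 0 := by
    rw [blockG_eq_zero] at hy ⊢
    exact ⟨hy.1, by simp [w, hy.2]⟩
  have hwn : ‖blockEmb L K w‖ = ‖blockEmb L K y‖ := by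
    simp [blockEmb_apply, w, WithLp.prod_norm_eq_of_L2]
  have hwx : blockEmb L K w + blockJ L K w = WithLp.toLp 2 (x₁, x₂) := by
    rw [one_smul] at hyx
    have e1 : GraphSpace.emb L y.fst - -GraphSpace.op K y.snd = x₁ := congrArg WithLp.fst hyx
    have e2 : GraphSpace.emb K y.snd - GraphSpace.op L y.fst = -x₂ := congrArg WithLp.snd hyx
    rw [blockEmb_apply, blockJ_apply, ← WithLp.toLp_add, Prod.mk_add_mk, toLp_prod_eq]
    constructor
    · simp [w, ← e1]
    · rw [← neg_inj, ← e2]; simp [w, sub_eq_neg_add]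
  -- Since `A (z + w) = z - w`, skewness at `z + w` reads `‖z‖² - ‖w‖² = 0`.
  have h0 := h.re_inner_blockJ (z := z + w) (by rw [map_add, hz, hw, add_zero])
  have h1 : blockJ L K (z + w) = blockEmb L K z - blockEmb L K w := by
    rw [one_smul, ← hwx, sub_eq_iff_eq_add] at hzx
    rw [map_add, hzx]; abel
  rw [h1, map_add, inner_add_right, inner_sub_left, inner_sub_left,
    ← inner_conj_symm (blockEmb L K w) (blockEmb L K z), inner_self_eq_norm_sq_to_K,
    inner_self_eq_norm_sq_to_K] at h0
  have h2 : ‖blockEmb L K z‖ ^ 2 = ‖blockEmb L K w‖ ^ 2 := by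
    simp only [Complex.add_re, Complex.sub_re, Complex.conj_re, Complex.coe_algebraMap,
      ← Complex.ofReal_pow, Complex.ofReal_re] at h0
    linarith
  rw [← hyR, ← hzR, ← hwn]
  exact ((pow_left_inj₀ (norm_nonneg _) (norm_nonneg _) two_ne_zero).1 h2).symm

/-! ### The splitting of the extrapolation space -/

theorem mem_extrapolationFst (x : X₁) :
    toExtrapolation R (WithLp.toLp 2 (x, 0)) ∈ extrapolationFst R :=
  Submodule.le_topologicalClosure _ ⟨_, rfl, rfl⟩

theorem mem_extrapolationSnd (x : X₂) :
    toExtrapolation R (WithLp.toLp 2 (0, x)) ∈ extrapolationSnd R :=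
  Submodule.le_topologicalClosure _ ⟨_, rfl, rfl⟩

theorem GreenIdentity.isCompl_extrapolation (h : GreenIdentity L K γ₁ γ₂ β₁ β₂)
    (hR : IsResolvent (blockEmb L K) (blockJ L K) (blockG γ₁ γ₂) 1 R) :
    IsCompl (extrapolationFst R) (extrapolationSnd R) := by
  let P : WithLp 2 (X₁ × X₂) →ₗ[ℂ] Extrapolation R :=
    (toExtrapolation R).toLinearMap ∘ₗ (WithLp.linearEquiv 2 ℂ (X₁ × X₂)).symm.toLinearMap ∘ₗ
      (LinearMap.inl ℂ X₁ X₂ ∘ₗ LinearMap.fst ℂ X₁ X₂) ∘ₗ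
      (WithLp.linearEquiv 2 ℂ (X₁ × X₂)).toLinearMap
  have hP : ∀ x, P x = toExtrapolation R (WithLp.toLp 2 (x.fst, 0)) := fun x => rfl
  obtain ⟨Q, hQ⟩ := exists_extension_extrapolation (R := R) P 1 (by
    rintro ⟨x₁, x₂⟩
    rw [hP, norm_toExtrapolation, one_mul]
    -- The projection is the mean of the identity and the reflection, an isometry for `‖R ·‖`, so it
    -- is a contraction and extends to a projection `Q` of `X₋₁`.
    have e : WithLp.toLp 2 (x₁, (0 : X₂)) =
        (2⁻¹ : ℂ) • (WithLp.toLp 2 (x₁, x₂) + WithLp.toLp 2 (x₁, -x₂)) := by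
      rw [← WithLp.toLp_add, ← WithLp.toLp_smul, Prod.mk_add_mk, Prod.smul_mk, toLp_prod_eq]
      constructor
      · rw [← two_smul ℂ, smul_smul]; norm_num
      · simp
    change ‖R (WithLp.toLp 2 (x₁, (0 : X₂)))‖ ≤ _
    rw [e, map_smul, map_add, norm_smul]
    have := norm_add_le (R (WithLp.toLp 2 (x₁, x₂))) (R (WithLp.toLp 2 (x₁, -x₂)))
    rw [h.norm_resolvent_reflect hR] at this
    norm_num
    linarith)
  have hfst : ∀ y ∈ extrapolationFst R, Q y = y := by
    intro y hy
    refine closure_minimal ?_ (isClosed_eq Q.continuous continuous_id) hy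
    rintro _ ⟨⟨x₁, x₂⟩, hx : x₂ = 0, rfl⟩
    subst hx
    exact hQ _
  have hsnd : ∀ y ∈ extrapolationSnd R, Q y = 0 := by
    intro y hy
    refine closure_minimal ?_ (isClosed_eq Q.continuous continuous_const) hy
    rintro _ ⟨⟨x₁, x₂⟩, hx : x₁ = 0, rfl⟩
    subst hx
    exact (hQ _).trans (map_zero (toExtrapolation R))
  have hmem : ∀ y, Q y ∈ extrapolationFst R := by
    intro y
    refine (denseRange_toExtrapolation R).induction_on y
      ((Submodule.isClosed_topologicalClosure _).preimage Q.continuous) fun x => ?_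
    rw [hQ, hP]
    exact mem_extrapolationFst _
  have hmem' : ∀ y, y - Q y ∈ extrapolationSnd R := by
    intro y
    refine (denseRange_toExtrapolation R).induction_on y
      ((Submodule.isClosed_topologicalClosure _).preimage
        (continuous_id.sub Q.continuous)) fun x => ?_
    have : x - WithLp.toLp 2 (x.fst, 0) = WithLp.toLp 2 (0, x.snd) := by
      refine WithLp.ofLp_injective 2 (Prod.ext ?_ ?_) <;> simp
    rw [hQ, hP, ← map_sub, this]
    exact mem_extrapolationSnd _
  refine ⟨?_, ?_⟩
  · rw [Submodule.disjoint_def]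
    intro y hy hy'
    rw [← hfst y hy, hsnd y hy']
  · rw [codisjoint_iff, eq_top_iff]
    intro y _
    exact Submodule.mem_sup.2 ⟨Q y, hmem y, y - Q y, hmem' y, by abel⟩

/-! ### Block form of the extended operator and of the control operator -/

theorem IsExtension.mem_extrapolationSnd
    (hA : IsExtension (blockEmb L K) (blockJ L K) (blockG γ₁ γ₂) R Aext)
    (h₁ : Dense (GraphSpace.emb L '' {z | γ₁ z = 0})) (x : X₁) :
    Aext (WithLp.toLp 2 (x, 0)) ∈ extrapolationSnd R := by
  have hc : Continuous fun x : X₁ => Aext (WithLp.toLp 2 (x, (0 : X₂))) :=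
    Aext.continuous.comp ((WithLp.prod_continuous_toLp 2 X₁ X₂).comp (by fun_prop))
  -- `A` exchanges the components on its domain; density and closedness carry this over to the
  -- extension.
  refine ((Submodule.isClosed_topologicalClosure _).preimage hc).closure_subset_iff.2 ?_ (h₁ x)
  rintro _ ⟨z, hz, rfl⟩
  have : Aext (WithLp.toLp 2 (GraphSpace.emb L z, GraphSpace.emb K 0))
      = toExtrapolation R (WithLp.toLp 2 (-GraphSpace.op K 0, GraphSpace.op L z)) :=
    hA (WithLp.toLp 2 (z, 0)) (blockG_eq_zero.2 ⟨hz, map_zero _⟩)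
  rw [map_zero, map_zero, neg_zero] at this
  change Aext (WithLp.toLp 2 (GraphSpace.emb L z, (0 : X₂))) ∈ extrapolationSnd R
  rw [this]
  exact PortHamiltonian.mem_extrapolationSnd _

theorem IsExtension.mem_extrapolationFst
    (hA : IsExtension (blockEmb L K) (blockJ L K) (blockG γ₁ γ₂) R Aext)
    (h₂ : Dense (GraphSpace.emb K '' {z | γ₂ z = 0})) (x : X₂) :
    Aext (WithLp.toLp 2 (0, x)) ∈ extrapolationFst R := by
  have hc : Continuous fun x : X₂ => Aext (WithLp.toLp 2 ((0 : X₁), x)) :=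
    Aext.continuous.comp ((WithLp.prod_continuous_toLp 2 X₁ X₂).comp (by fun_prop))
  refine ((Submodule.isClosed_topologicalClosure _).preimage hc).closure_subset_iff.2 ?_ (h₂ x)
  rintro _ ⟨z, hz, rfl⟩
  have : Aext (WithLp.toLp 2 (GraphSpace.emb L 0, GraphSpace.emb K z))
      = toExtrapolation R (WithLp.toLp 2 (-GraphSpace.op K z, GraphSpace.op L 0)) :=
    hA (WithLp.toLp 2 (0, z)) (blockG_eq_zero.2 ⟨map_zero _, hz⟩)
  rw [map_zero, map_zero] at this
  change Aext (WithLp.toLp 2 ((0 : X₁), GraphSpace.emb K z)) ∈ extrapolationFst R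
  rw [this]
  exact PortHamiltonian.mem_extrapolationFst _

theorem blockB_apply (B₁ : U₁ →L[ℂ] extrapolationSnd R) (B₂ : U₂ →L[ℂ] extrapolationFst R)
    (u : WithLp 2 (U₁ × U₂)) : blockB B₁ B₂ u = B₁ u.fst + B₂ u.snd := rfl

theorem blockB_inj {B₁ B₁' : U₁ →L[ℂ] extrapolationSnd R} {B₂ B₂' : U₂ →L[ℂ] extrapolationFst R}
    (h : blockB B₁ B₂ = blockB B₁' B₂') : B₁ = B₁' ∧ B₂ = B₂' := by
  constructor <;> ext u
  · have := DFunLike.congr_fun h (WithLp.toLp 2 (u, 0))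
    simpa [blockB_apply] using this
  · have := DFunLike.congr_fun h (WithLp.toLp 2 (0, u))
    simpa [blockB_apply] using this

/-- Lift an input with one zero component to a solution with one zero component: `J` and `A|_X` both
exchange the components, hence so does `B G = J - A|_X`. -/
theorem IsExtension.exists_blockB
    (hA : IsExtension (blockEmb L K) (blockJ L K) (blockG γ₁ γ₂) R Aext)
    (h₁ : Dense (GraphSpace.emb L '' {z | γ₁ z = 0}))
    (h₂ : Dense (GraphSpace.emb K '' {z | γ₂ z = 0}))
    (hγ₁ : Function.Surjective γ₁) (hγ₂ : Function.Surjective γ₂)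
    {B : WithLp 2 (U₁ × U₂) →L[ℂ] Extrapolation R}
    (hB : ∀ z, toExtrapolation R (blockJ L K z)
      = Aext (blockEmb L K z) + B (blockG γ₁ γ₂ z)) :
    ∃ (B₁ : U₁ →L[ℂ] extrapolationSnd R) (B₂ : U₂ →L[ℂ] extrapolationFst R),
      B = blockB B₁ B₂ := by
  have e1 : ∀ u : U₁, B (WithLp.toLp 2 (u, 0)) ∈ extrapolationSnd R := fun u => by
    obtain ⟨z, rfl⟩ := hγ₁ u
    have : toExtrapolation R (WithLp.toLp 2 (-GraphSpace.op K 0, GraphSpace.op L z))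
        = Aext (WithLp.toLp 2 (GraphSpace.emb L z, GraphSpace.emb K 0))
          + B (WithLp.toLp 2 (γ₁ z, γ₂ 0)) := hB (WithLp.toLp 2 (z, 0))
    rw [map_zero, map_zero, map_zero, neg_zero, ← sub_eq_iff_eq_add'] at this
    rw [← this]
    exact Submodule.sub_mem _ (PortHamiltonian.mem_extrapolationSnd _)
      (hA.mem_extrapolationSnd h₁ _)
  have e2 : ∀ u : U₂, B (WithLp.toLp 2 (0, u)) ∈ extrapolationFst R := fun u => by
    obtain ⟨z, rfl⟩ := hγ₂ u
    have : toExtrapolation R (WithLp.toLp 2 (-GraphSpace.op K z, GraphSpace.op L 0))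
        = Aext (WithLp.toLp 2 (GraphSpace.emb L 0, GraphSpace.emb K z))
          + B (WithLp.toLp 2 (γ₁ 0, γ₂ z)) := hB (WithLp.toLp 2 (0, z))
    rw [map_zero, map_zero, map_zero, ← sub_eq_iff_eq_add'] at this
    rw [← this]
    exact Submodule.sub_mem _ (PortHamiltonian.mem_extrapolationFst _)
      (hA.mem_extrapolationFst h₂ _)
  let I := (WithLp.prodContinuousLinearEquiv 2 ℂ U₁ U₂).symm.toContinuousLinearMap
  refine ⟨(B.comp (I.comp (ContinuousLinearMap.inl ℂ U₁ U₂))).codRestrict _ e1,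
    (B.comp (I.comp (ContinuousLinearMap.inr ℂ U₁ U₂))).codRestrict _ e2, ?_⟩
  ext u
  change B u = B (WithLp.toLp 2 (u.fst, 0)) + B (WithLp.toLp 2 (0, u.snd))
  rw [← map_add, ← WithLp.toLp_add, Prod.mk_add_mk, add_zero, zero_add]
  rfl

theorem exists_sub_blockJ_eq
    (hs : ∀ x₁ x₂, ∃ z₁ z₂, γ₁ z₁ = 0 ∧ γ₂ z₂ = 0 ∧
      GraphSpace.emb L z₁ + GraphSpace.op K z₂ = x₁ ∧
      GraphSpace.emb K z₂ - GraphSpace.op L z₁ = x₂) (x : WithLp 2 (X₁ × X₂)) :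
    ∃ z, blockG γ₁ γ₂ z = 0 ∧ blockEmb L K z - blockJ L K z = x := by
  obtain ⟨x₁, x₂⟩ := x
  obtain ⟨z₁, z₂, h1, h2, rfl, rfl⟩ := hs x₁ x₂
  refine ⟨WithLp.toLp 2 (z₁, z₂), blockG_eq_zero.2 ⟨h1, h2⟩, ?_⟩
  rw [← sub_neg_eq_add]
  rfl

theorem IsControlOperator.blockB_unique {B₁ B₁' : U₁ →L[ℂ] extrapolationSnd R}
    {B₂ B₂' : U₂ →L[ℂ] extrapolationFst R} (hG : Function.Surjective (blockG γ₁ γ₂))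
    (h : IsControlOperator (blockEmb L K) (blockJ L K) (blockG γ₁ γ₂) R Aext (blockB B₁ B₂))
    (h' : IsControlOperator (blockEmb L K) (blockJ L K) (blockG γ₁ γ₂) R Aext (blockB B₁' B₂')) :
    B₁' = B₁ ∧ B₂' = B₂ :=
  blockB_inj (control_unique hG h.eq h'.eq)

/-- The form of the structure operator, on the solution space, is skew-symmetric. -/
theorem GreenIdentity.skew (h : GreenIdentity L K γ₁ γ₂ β₁ β₂) (z y : SolutionSpace L K) :
    conj (⟪blockJ L K z, blockEmb L K y⟫_ℂ - (β₂ z.snd (γ₁ y.fst) + β₁ z.fst (γ₂ y.snd)))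
      + (⟪blockJ L K y, blockEmb L K z⟫_ℂ - (β₂ y.snd (γ₁ z.fst) + β₁ y.fst (γ₂ z.snd))) = 0 := by
  -- The Green identity is used on the mixed pairs `(y¹, z²)` and `(z¹, y²)`, the second one
  -- conjugated.
  have h1 := h y.fst z.snd
  have h2 := congrArg conj (h z.fst y.snd)
  rw [WithLp.prod_inner_apply, WithLp.prod_inner_apply]
  change conj (⟪-GraphSpace.op K z.snd, GraphSpace.emb L y.fst⟫_ℂ
    + ⟪GraphSpace.op L z.fst, GraphSpace.emb K y.snd⟫_ℂ - _)
    + (⟪-GraphSpace.op K y.snd, GraphSpace.emb L z.fst⟫_ℂ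
    + ⟪GraphSpace.op L y.fst, GraphSpace.emb K z.snd⟫_ℂ - _) = 0
  simp only [map_add, map_sub, map_neg, inner_neg_left, inner_conj_symm, Complex.conj_conj]
    at h2 ⊢
  rw [h1, h2]
  ring

/-- A bounded solution operator of the effort space yields the extended structure operator. -/
theorem GreenIdentity.exists_structureOperator [CompleteSpace X₁] [CompleteSpace X₂]
    [CompleteSpace U₁] [CompleteSpace U₂] (h : GreenIdentity L K γ₁ γ₂ β₁ β₂)
    {B : WithLp 2 (U₁ × U₂) →L[ℂ] Extrapolation R}
    (Φ : EffortSpace R Aext B →L[ℂ] SolutionSpace L K)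
    (hΦ : ∀ p, blockEmb L K (Φ p) = p.1.fst.fst ∧ blockG γ₁ γ₂ (Φ p) = p.1.fst.snd ∧
      blockJ L K (Φ p) = p.1.snd) :
    ∃ T : EffortSpace R Aext B →L⋆[ℂ] StrongDual ℂ (EffortSpace R Aext B),
      IsExtendedStructureOperator γ₁ γ₂ β₁ β₂ R Aext B T ∧ IsStokesDirac (dualGraph (E := EffortSpace R Aext B) T) := by
  -- The form lives on `Z`; `T` is its pullback along `Φ`, so boundedness and skewness are
  -- inherited.
  let S : SolutionSpace L K →L⋆[ℂ] StrongDual ℂ (SolutionSpace L K) :=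
    ((blockEmb L K).precomp ℂ).comp ((innerSL ℂ).comp (blockJ L K))
      - (((γ₁.comp (WithLp.fstL 2 ℂ _ _)).precomp ℂ).comp (β₂.comp (WithLp.sndL 2 ℂ _ _))
        + ((γ₂.comp (WithLp.sndL 2 ℂ _ _)).precomp ℂ).comp (β₁.comp (WithLp.fstL 2 ℂ _ _)))
  have hS : ∀ z y, S z y =
      ⟪blockJ L K z, blockEmb L K y⟫_ℂ - (β₂ z.snd (γ₁ y.fst) + β₁ z.fst (γ₂ y.snd)) :=
    fun z y => rfl
  refine ⟨(Φ.precomp ℂ).comp (S.comp Φ), fun p => ⟨Φ p, (hΦ p).1, (hΦ p).2.1, fun q => ?_⟩,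
    isStokesDirac_dualGraph _ fun p q => ?_⟩
  · change S (Φ p) (Φ q) = _
    rw [hS, ← (hΦ p).2.2, ← (hΦ q).1, ← (hΦ q).2.1]
    rfl
  · change conj (S (Φ p) (Φ q)) + S (Φ q) (Φ p) = 0
    rw [hS, hS]
    exact h.skew _ _

end System

end PortHamiltonian

/-! ### The main theorem -/

theorem mainTheorem3
    {X₁ X₂ U₁ U₂ : Type*}
    [NormedAddCommGroup X₁] [InnerProductSpace ℂ X₁] [CompleteSpace X₁]
    [NormedAddCommGroup X₂] [InnerProductSpace ℂ X₂] [CompleteSpace X₂]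
    [NormedAddCommGroup U₁] [InnerProductSpace ℂ U₁] [CompleteSpace U₁]
    [NormedAddCommGroup U₂] [InnerProductSpace ℂ U₂] [CompleteSpace U₂]
    (L : X₁ →ₗ.[ℂ] X₂) (K : X₂ →ₗ.[ℂ] X₁)
    (hL : L.IsClosed) (hLd : Dense (L.domain : Set X₁))
    (hK : K.IsClosed) (hKd : Dense (K.domain : Set X₂))
    (γ₁ : GraphSpace L →L[ℂ] U₁)
    (γ₂ : GraphSpace K →L[ℂ] U₂)
    (β₁ : GraphSpace L →L⋆[ℂ] StrongDual ℂ U₂)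
    (β₂ : GraphSpace K →L⋆[ℂ] StrongDual ℂ U₁)
    -- abstract Green identity
    (hGreen : ∀ (z₁ : GraphSpace L) (z₂ : GraphSpace K),
      ⟪GraphSpace.op L z₁, GraphSpace.emb K z₂⟫_ℂ
        = ⟪GraphSpace.emb L z₁, GraphSpace.op K z₂⟫_ℂ
          + conj (β₂ z₂ (γ₁ z₁)) + β₁ z₁ (γ₂ z₂))
    (hγ₁ : Function.Surjective γ₁) (hγ₂ : Function.Surjective γ₂)
    (hker₁ : Dense (GraphSpace.emb L '' {z | γ₁ z = 0}))
    (hker₂ : Dense (GraphSpace.emb K '' {z | γ₂ z = 0}))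
    (hβ :
      (Dense (GraphSpace.emb L '' {z | γ₁ z = 0 ∧ β₁ z = 0}) ∧
        (∀ g : StrongDual ℂ U₂, ∃ z, γ₁ z = 0 ∧ β₁ z = g) ∧
        -- the domain of `K` is maximal
        (∀ (v : X₂) (w : X₁),
          (∀ z : GraphSpace L, γ₁ z = 0 → β₁ z = 0 →
            ⟪GraphSpace.op L z, v⟫_ℂ
              = ⟪GraphSpace.emb L z, w⟫_ℂ) →
          v ∈ K.domain)) ∨
      (Dense (GraphSpace.emb K '' {z | γ₂ z = 0 ∧ β₂ z = 0}) ∧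
        (∀ g : StrongDual ℂ U₁, ∃ z, γ₂ z = 0 ∧ β₂ z = g) ∧
        -- the domain of `L` is maximal
        (∀ (v : X₁) (w : X₂),
          (∀ z : GraphSpace K, γ₂ z = 0 → β₂ z = 0 →
            ⟪GraphSpace.op K z, v⟫_ℂ
              = ⟪GraphSpace.emb K z, w⟫_ℂ) →
          v ∈ L.domain))) :
    -- `(J, G)` is a boundary control system, and `I - A` is boundedly invertible
    IsBoundaryControlSystem (blockEmb L K)
      (blockJ L K) (blockG γ₁ γ₂) ∧
    (∃! R : WithLp 2 (X₁ × X₂) →L[ℂ] WithLp 2 (X₁ × X₂),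
      IsResolvent (blockEmb L K)
        (blockJ L K) (blockG γ₁ γ₂) 1 R) ∧
    ∀ R : WithLp 2 (X₁ × X₂) →L[ℂ] WithLp 2 (X₁ × X₂),
      IsResolvent (blockEmb L K)
        (blockJ L K) (blockG γ₁ γ₂) 1 R →
      -- the extrapolation space is the direct sum of its components, and `A` extends to `X`
      Function.Injective (toExtrapolation R) ∧
      IsCompl (extrapolationFst R) (extrapolationSnd R) ∧
      (∃! Aext : WithLp 2 (X₁ × X₂) →L[ℂ] Extrapolation R,
        IsExtension (blockEmb L K)
          (blockJ L K) (blockG γ₁ γ₂) R Aext) ∧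
      ∀ Aext : WithLp 2 (X₁ × X₂) →L[ℂ] Extrapolation R,
        IsExtension (blockEmb L K)
          (blockJ L K) (blockG γ₁ γ₂) R Aext →
        ∃ (B₁ : U₁ →L[ℂ] extrapolationSnd R)
          (B₂ : U₂ →L[ℂ] extrapolationFst R),
          -- existence and uniqueness of the control operators
          IsControlOperator (blockEmb L K)
            (blockJ L K) (blockG γ₁ γ₂) R Aext
            (blockB B₁ B₂) ∧
          (∀ B' : WithLp 2 (U₁ × U₂) →L[ℂ] Extrapolation R,
            (∀ z, toExtrapolation R (blockJ L K z)
              = Aext (blockEmb L K z)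
                + B' (blockG γ₁ γ₂ z)) →
            B' = blockB B₁ B₂) ∧
          (∀ (B₁' : U₁ →L[ℂ] extrapolationSnd R)
              (B₂' : U₂ →L[ℂ] extrapolationFst R),
            IsControlOperator (blockEmb L K)
              (blockJ L K) (blockG γ₁ γ₂) R Aext
              (blockB B₁' B₂') → B₁' = B₁ ∧ B₂' = B₂) ∧
          -- the graph of the extended structure operator is a Stokes-Dirac structure
          ∃ T : EffortSpace R Aext (blockB B₁ B₂) →L⋆[ℂ]
              StrongDual ℂ
                (EffortSpace R Aext (blockB B₁ B₂)),
            IsExtendedStructureOperator γ₁ γ₂ β₁ β₂ R Aext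
              (blockB B₁ B₂) T ∧
            IsStokesDirac (dualGraph (E := EffortSpace R Aext (blockB B₁ B₂)) T) := by
  have hg : GreenIdentity L K γ₁ γ₂ β₁ β₂ := hGreen
  have hZ₁ := completeSpace_graphSpace hL
  have hZ₂ := completeSpace_graphSpace hK
  have hs : ∀ x, ∃ z, blockG γ₁ γ₂ z = 0 ∧ blockEmb L K z - blockJ L K z = x := by
    refine exists_sub_blockJ_eq fun x₁ x₂ => ?_
    rcases hβ with ⟨hd, hs, hm⟩ | ⟨hd, hs, hm⟩
    · exact (hg.adjointLe hd hs hm).exists_decomposition hL x₁ x₂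
    · refine (hg.swap.adjointLe ?_ (fun f => ?_) fun v w hvw =>
        hm v w fun z hz hz' => hvw z hz ?_).exists_decomposition' hK x₁ x₂
      · simpa only [neg_apply, neg_eq_zero] using hd
      -- The exchanged Green identity carries `-β₂`, hence the sign.
      · obtain ⟨z, hz, hz'⟩ := hs (-f)
        exact ⟨z, hz, by rw [neg_apply, hz', neg_neg]⟩
      · rw [neg_apply, hz', neg_zero]
  have hd := dense_blockEmb_ker hker₁ hker₂
  have hG := blockG_surjective hγ₁ hγ₂
  have hι : Function.Injective (blockEmb L K) := blockEmb_injective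
  refine ⟨⟨inferInstance, inferInstance, inferInstance, hι, hG, hd, 1, fun x => ?_,
    fun z hz hz0 => ?_⟩, ?_, fun R hR => ⟨hR.toExtrapolation_injective hι,
      hg.isCompl_extrapolation hR, ?_, fun Aext hA => ?_⟩⟩
  · simpa only [one_smul] using hs x
  · have := hg.norm_le hz0
    rw [one_smul] at hz
    rw [hz, norm_zero] at this
    exact hι (by rw [norm_le_zero_iff.1 this, map_zero])
  · obtain ⟨R, hR⟩ := hg.exists_isResolvent hs
    exact ⟨R, hR, fun R' hR' => hR.unique hR'⟩
  · obtain ⟨Aext, hA⟩ := hR.exists_isExtension hd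
    exact ⟨Aext, hA, fun A' hA' => hA.unique hd hA'⟩
  · obtain ⟨B, hB⟩ := hA.exists_control hG
    obtain ⟨B₁, B₂, rfl⟩ := hA.exists_blockB hker₁ hker₂ hγ₁ hγ₂ hB
    obtain ⟨Φ, hΦ⟩ := hA.exists_effortSolution hR hι hG hd hB
    have hB' := hA.isControlOperator hR hι hG hd hB
    exact ⟨B₁, B₂, hB', fun B' h => control_unique hG hB h,
      fun B₁' B₂' h => hB'.blockB_unique hG h, hg.exists_structureOperator Φ hΦ⟩
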